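/- Let $k$ be an algebraically closed field of characteristic zero, let $k^{\ast}=k\setminus\{0\}$ be its multiplicative group, and let $m,n\ge 1$ be integers. Write $\mathbb{Z}_r$ for the cyclic group of order $r$ and $(m,n)$ for the greatest common divisor of $m$ and $n$. Then, with $\mathbb{Z}_m\times\mathbb{Z}_n$ acting trivially on $k^{\ast}$, the third group cohomology satisfies $$\operatorname{H}^{3}(\mathbb{Z}_{m}\times\mathbb{Z}_{n},k^{\ast})\;\cong\;\mathbb{Z}_{m}\times\mathbb{Z}_{(m,n)}\times\mathbb{Z}_{n}$$ as abelian groups. -/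

import Mathlib

universe u

/-- The third cohomology group `H³(G, kˣ)` of a group `G` with coefficients in the multiplicative
group `kˣ` of a field, on which `G` acts trivially.  The group `kˣ` is written additively and
regarded as a `ℤ`-module; the copy `ULift ℤ` of `ℤ` only serves to allow `k` and `G` in an
arbitrary universe. -/
noncomputable abbrev H3Units (k : Type u) [Field k] (G : Type u) [Group G] :
    ModuleCat.{u} (ULift.{u} ℤ) :=
  groupCohomology (Rep.trivial (ULift.{u} ℤ) G (Additive kˣ)) 3

/-! Let `s`, `t` generate the two factors of `G`. Each cyclic group has a periodic free resolution
whose differentials alternate between `t - 1` and the norm `1 + t + ⋯`; the total complex of their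
tensor product is a free resolution of the trivial module over the group algebra of `G`
(`resolution`). Exactness needs no Künneth formula: the columns are exact because `G` splits along
`t`, the rows are exact modulo `t - 1`, and a staircase argument
(`exists_total_boundary_of_total_cycle`) combines the two.

Maps into a trivial module `V` see only augmentations, so `t - 1` becomes `0` and the norms become
`m` and `n`. A 3-cocycle is then `(v₀, v₁, v₂, v₃)` with `n v₀ = 0`, `m v₁ + n v₂ = 0`, `m v₃ = 0`,
and the coboundaries are `(0, -n w, m w, 0)`. With `g = (m, n)` and `V` divisible by `g`, the map
`(v₁, v₂) ↦ (m/g) v₁ + (n/g) v₂` identifies the middle part with the `g`-torsion of `V`. For `V =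
kˣ` the torsion groups are groups of roots of unity, cyclic of full order. -/

open CategoryTheory MonoidAlgebra

/-! ### Exactness of a total complex. -/

section DoubleComplex

variable {B : Type*} [CommRing B] {a b : ℕ → B}

/-- Exactness in positive degree of the total complex of a double complex `x i j ∈ B` with
horizontal differentials `a` and vertical differentials `b`. -/
theorem exists_total_boundary_of_total_cycle
    (hb : ∀ j x, b (j + 1) * x = 0 → ∃ y, x = b (j + 2) * y)
    (ha : ∀ i x, b 1 ∣ a (i + 1) * x → ∃ y z, x = a (i + 2) * y + b 1 * z)
    (haa : ∀ i, a (i + 1) * a (i + 2) = 0)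
    (q : ℕ) (x : ℕ → B)
    (hx : ∀ i ≤ q, a (i + 1) * x (i + 1) + (-1) ^ i * b (q + 1 - i) * x i = 0) :
    ∃ y : ℕ → B, ∀ i ≤ q + 1,
      a (i + 1) * y (i + 1) + (-1) ^ i * b (q + 2 - i) * y i = x i := by
  -- Staircase: solve from the component of vertical degree `0` downwards in `i`, adjusting one new
  -- `y i` at each step.
  suffices H : ∀ r ≤ q + 1, ∃ y : ℕ → B, ∀ i ≤ q + 1, q + 1 - r ≤ i →
      a (i + 1) * y (i + 1) + (-1) ^ i * b (q + 2 - i) * y i = x i by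
    obtain ⟨y, hy⟩ := H (q + 1) le_rfl
    exact ⟨y, fun i hi => hy i hi (by omega)⟩
  intro r
  induction r with
  | zero =>
    intro _
    have h := hx q le_rfl
    rw [show q + 1 - q = 1 by omega] at h
    obtain ⟨y, z, hyz⟩ := ha q (x (q + 1)) ⟨-(-1) ^ q * x q, by linear_combination h⟩
    -- Only the values at `q + 1` and `q + 2` matter here, so the default branch supplies the
    -- former.
    refine ⟨fun i => if i = q + 2 then y else (-1) ^ (q + 1) * z, fun i hi hi' => ?_⟩
    obtain rfl : i = q + 1 := by omega
    have h1 : ((-1 : B) ^ (q + 1)) * (-1) ^ (q + 1) = 1 := by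
      rw [← mul_pow]; simp
    simp only [if_true, show q + 1 + 1 = q + 2 by omega, show q + 2 - (q + 1) = 1 by omega,
      show q + 1 ≠ q + 2 by omega, if_false]
    rw [hyz]
    linear_combination (b 1 * z) * h1
  | succ r ih =>
    intro hr
    obtain ⟨y, hy⟩ := ih (by omega)
    obtain ⟨j, rfl⟩ : ∃ j, q = r + j := ⟨q - r, by omega⟩
    have h1 : ((-1 : B) ^ j) * (-1) ^ j = 1 := by
      rw [← mul_pow]; simp
    have h := hx j (by omega)
    have h' := hy (j + 1) (by omega) (by omega)
    rw [show r + j + 1 - j = r + 1 by omega] at h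
    rw [show r + j + 2 - (j + 1) = r + 1 by omega] at h'
    -- The cycle condition and the equation already solved at `j + 1` make this difference a
    -- vertical cycle.
    obtain ⟨w, hw⟩ := hb r (x j - a (j + 1) * y (j + 1)) (by
      rw [pow_succ] at h'
      linear_combination (-1) ^ j * h + (-1) ^ j * a (j + 1) * h'
        - (-1) ^ j * y (j + 2) * haa j - (b (r + 1) * (x j - a (j + 1) * y (j + 1))) * h1)
    refine ⟨fun i => if i = j then (-1) ^ j * w else y i, fun i hi hi' => ?_⟩
    rcases eq_or_ne i j with rfl | hij
    · simp only [if_true, show i + 1 ≠ i by omega, if_false, show r + i + 2 - i = r + 2 by omega]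
      linear_combination (b (r + 2) * w) * h1 - hw
    · simp only [hij, show i + 1 ≠ j by omega, if_false]
      exact hy i hi (by omega)

end DoubleComplex

/-! ### Exactness of the periodic coefficients in the group algebra. -/

namespace MonoidAlgebra

open Finset

section Cyclic

variable (k : Type*) [CommRing k] {G : Type*} [CommGroup G] (t : G) (n : ℕ)

/-- The element `1 + t + ⋯ + t ^ (n - 1)` of the group algebra. -/
noncomputable def cyclicNorm : MonoidAlgebra k G := ∑ i ∈ range n, of k G t ^ i

/-- The coefficients `t - 1` (in odd degree) and `1 + t + ⋯ + t ^ (n - 1)` (in even degree) of the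
periodic resolution for a cyclic group of order `n` with generator `t`. -/
noncomputable def periodicCoeff (i : ℕ) : MonoidAlgebra k G :=
  if Even i then cyclicNorm k t n else of k G t - 1

variable {t n}

theorem sub_one_mul_cyclicNorm (ht : t ^ n = 1) : (of k G t - 1) * cyclicNorm k t n = 0 := by
  rw [cyclicNorm, mul_geom_sum, ← map_pow, ht, map_one, sub_self]

theorem periodicCoeff_mul_periodicCoeff (ht : t ^ n = 1) (i : ℕ) :
    periodicCoeff k t n i * periodicCoeff k t n (i + 1) = 0 := by
  by_cases h : Even i
  · simpa only [periodicCoeff, h, Nat.even_add_one, mul_comm (cyclicNorm k t n), if_true,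
      not_true, if_false] using sub_one_mul_cyclicNorm k ht
  · simpa only [periodicCoeff, h, Nat.even_add_one, if_true, not_false_iff, if_false] using
      sub_one_mul_cyclicNorm k ht

variable {P : G →* G}

theorem sub_one_dvd_sub_mapDomainAlgHom (hP : ∀ g, ∃ i : ℕ, g = P g * t ^ i)
    (x : MonoidAlgebra k G) :
    of k G t - 1 ∣ x - mapDomainAlgHom k k P x := by
  induction x using MonoidAlgebra.induction_linear with
  | zero => simp
  | add x y hx hy =>
    rw [map_add, add_sub_add_comm]
    exact dvd_add hx hy
  | single g r =>
    obtain ⟨i, hi⟩ := hP g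
    have h : single g r - mapDomainAlgHom k k P (single g r) =
        (of k G t ^ i - 1 ^ i) * single (P g) r := by
      rw [← map_pow, one_pow, sub_mul, one_mul]
      simp only [of_apply, single_mul_single, one_mul, mapDomainAlgHom_apply, mapDomain_single]
      rw [mul_comm (t ^ i), ← hi]
    rw [h]
    exact dvd_mul_of_dvd_left (sub_dvd_pow_sub_pow _ _ _) _

theorem mapDomainAlgHom_sub_one_mul (hPt : P t = 1) (x : MonoidAlgebra k G) :
    mapDomainAlgHom k k P ((of k G t - 1) * x) = 0 := by
  have h : mapDomainAlgHom k k P (of k G t) = 1 := by simp [hPt, one_def]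
  rw [map_mul, map_sub, h, map_one, sub_self, zero_mul]

theorem coeff_cyclicNorm_mul (x : MonoidAlgebra k G) (g : G) :
    (cyclicNorm k t n * x).coeff g = ∑ i ∈ range n, x.coeff ((t ^ i)⁻¹ * g) := by
  rw [cyclicNorm, sum_mul, coeff_sum, Finsupp.finsetSum_apply]
  refine sum_congr rfl fun i _ => ?_
  rw [← map_pow, of_apply, coeff_single_mul_apply, one_mul]

theorem coeff_mapDomainAlgHom_of_ne (hPP : ∀ g, P (P g) = P g) (x : MonoidAlgebra k G) {g : G}
    (hg : P g ≠ g) : (mapDomainAlgHom k k P x).coeff g = 0 := by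
  induction x using MonoidAlgebra.induction_linear with
  | zero => simp
  | add x y hx hy => rw [map_add, coeff_add, Finsupp.add_apply, hx, hy, add_zero]
  | single h r =>
    simp only [mapDomainAlgHom_apply, mapDomain_single, coeff_single]
    refine Finsupp.single_eq_of_ne fun e => hg ?_
    rw [e, hPP]

/-- The norm kills `x - P x`, hence also `P x`. As `P x` lives on the fixed points of `P`, a
transversal of `⟨t⟩`, its translates by powers of `t` have disjoint supports and cannot cancel. -/
theorem mapDomainAlgHom_eq_zero_of_cyclicNorm_mul_eq_zero (hn : 0 < n)
    (hP : ∀ g, ∃ i : ℕ, g = P g * t ^ i) (hPt : P t = 1) (ht : orderOf t = n)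
    {x : MonoidAlgebra k G} (hx : cyclicNorm k t n * x = 0) : mapDomainAlgHom k k P x = 0 := by
  have hPP : ∀ g, P (P g) = P g := fun g => by
    obtain ⟨i, hi⟩ := hP g
    conv_rhs => rw [hi]
    simp [hPt]
  obtain ⟨w, hw⟩ := sub_one_dvd_sub_mapDomainAlgHom k hP x
  have hN : cyclicNorm k t n * mapDomainAlgHom k k P x = 0 := by
    linear_combination hx - cyclicNorm k t n * hw -
      w * sub_one_mul_cyclicNorm k (ht ▸ pow_orderOf_eq_one t)
  ext g
  by_cases hg : P g = g
  · have h := congr(($hN).coeff g)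
    rw [coeff_cyclicNorm_mul, sum_eq_single 0] at h
    · simpa using h
    · intro i hi hi0
      refine coeff_mapDomainAlgHom_of_ne k hPP x fun e => hi0 ?_
      rw [map_mul, map_inv, map_pow, hPt, one_pow, inv_one, one_mul, hg, eq_comm,
        mul_eq_right, inv_eq_one, ← orderOf_dvd_iff_pow_eq_one, ht] at e
      exact Nat.eq_zero_of_dvd_of_lt e (mem_range.1 hi)
    · simp [hn.ne']
  · rw [coeff_mapDomainAlgHom_of_ne k hPP x hg, coeff_zero, Finsupp.zero_apply]

theorem sub_one_dvd_of_cyclicNorm_mul_eq_zero (hn : 0 < n)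
    (hP : ∀ g, ∃ i : ℕ, g = P g * t ^ i) (hPt : P t = 1) (ht : orderOf t = n)
    {x : MonoidAlgebra k G} (hx : cyclicNorm k t n * x = 0) : of k G t - 1 ∣ x := by
  simpa [mapDomainAlgHom_eq_zero_of_cyclicNorm_mul_eq_zero k hn hP hPt ht hx] using
    sub_one_dvd_sub_mapDomainAlgHom k hP x

theorem cyclicNorm_dvd_of_sub_one_mul_eq_zero (hn : 0 < n)
    (hP : ∀ g, ∃ i : ℕ, g = P g * t ^ i) (hPt : P t = 1) (ht : orderOf t = n)
    {x : MonoidAlgebra k G} (hx : (of k G t - 1) * x = 0) : cyclicNorm k t n ∣ x := by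
  classical
  have hTx : ∀ (i : ℕ) g, x.coeff (t ^ i * g) = x.coeff g := fun i g => by
    have h : of k G t ^ i * x = x := by
      obtain ⟨w, hw⟩ := sub_dvd_pow_sub_pow (of k G t) 1 i
      rw [one_pow] at hw
      linear_combination x * hw + w * hx
    conv_lhs => rw [← h]
    rw [← map_pow, of_apply, coeff_single_mul_apply, one_mul, inv_mul_cancel_left]
  -- Since `x` is constant on cosets of `⟨t⟩`, it is the norm times its restriction to the
  -- transversal.
  refine ⟨ofCoeff (x.coeff.filter fun g => P g = g), ?_⟩
  ext g
  rw [coeff_cyclicNorm_mul]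
  obtain ⟨i, hi⟩ := hP g
  have hi' : (t ^ (i % n))⁻¹ * g = P g := by
    conv_lhs => rw [hi, ← ht, pow_mod_orderOf]
    rw [mul_comm, mul_inv_cancel_right]
  rw [sum_eq_single (i % n)]
  · have hPP : P (P g) = P g := by
      conv_rhs => rw [hi]
      simp [hPt]
    rw [hi', coeff_ofCoeff, Finsupp.filter_apply_pos (fun g => P g = g) _ hPP,
      ← hTx i (P g), mul_comm, ← hi]
  · intro j hj hji
    rw [coeff_ofCoeff, Finsupp.filter_apply_neg]
    rw [map_mul, map_inv, map_pow, hPt, one_pow, inv_one, one_mul, eq_inv_mul_iff_mul_eq, mul_comm]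
    intro e
    apply hji
    rw [← hi', mul_comm, ← mul_assoc, mul_eq_right, mul_inv_eq_one] at e
    subst ht
    exact pow_injOn_Iio_orderOf (mem_range.1 hj) (Nat.mod_lt _ hn) e
  · intro h
    exact absurd (mem_range.2 (Nat.mod_lt _ hn)) h

theorem exists_eq_periodicCoeff_mul (hn : 0 < n)
    (hP : ∀ g, ∃ i : ℕ, g = P g * t ^ i) (hPt : P t = 1) (ht : orderOf t = n)
    (j : ℕ) (x : MonoidAlgebra k G) (hx : periodicCoeff k t n j * x = 0) :
    ∃ y, x = periodicCoeff k t n (j + 1) * y := by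
  by_cases h : Even j
  · simp only [periodicCoeff, h, Nat.even_add_one, if_true, not_true, if_false] at hx ⊢
    exact sub_one_dvd_of_cyclicNorm_mul_eq_zero k hn hP hPt ht hx
  · simp only [periodicCoeff, h, Nat.even_add_one, if_true, not_false_iff, if_false] at hx ⊢
    exact cyclicNorm_dvd_of_sub_one_mul_eq_zero k hn hP hPt ht hx

end Cyclic

section TwoGenerators

variable (k : Type*) [CommRing k] {G : Type*} [CommGroup G] {s t : G} {m n : ℕ} {P Q : G →* G}

/-- Applying `P` kills multiples of `t - 1` and fixes the coefficients in `s`, so exactness along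
`s` applies to `P x`, which agrees with `x` modulo `t - 1`. -/
theorem exists_eq_periodicCoeff_mul_add (hm : 0 < m)
    (hQ : ∀ g, ∃ i : ℕ, g = Q g * s ^ i) (hQs : Q s = 1) (hs : orderOf s = m)
    (hP : ∀ g, ∃ i : ℕ, g = P g * t ^ i) (hPt : P t = 1) (hPs : P s = s)
    (i : ℕ) (x : MonoidAlgebra k G)
    (hx : periodicCoeff k t n 1 ∣ periodicCoeff k s m i * x) :
    ∃ y z, x = periodicCoeff k s m (i + 1) * y + periodicCoeff k t n 1 * z := by
  have h1 : periodicCoeff k t n 1 = of k G t - 1 := by simp [periodicCoeff]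
  rw [h1] at hx ⊢
  obtain ⟨w, hw⟩ := hx
  have hPa : mapDomainAlgHom k k P (periodicCoeff k s m i) = periodicCoeff k s m i := by
    have hof : mapDomainAlgHom k k P (of k G s) = of k G s := by simp [hPs]
    rw [periodicCoeff]
    split_ifs
    · simp only [cyclicNorm, map_sum, map_pow, hof]
    · rw [map_sub, hof, map_one]
  have h := congr(mapDomainAlgHom k k P $hw)
  rw [mapDomainAlgHom_sub_one_mul k hPt, map_mul, hPa] at h
  obtain ⟨y, hy⟩ := exists_eq_periodicCoeff_mul k hm hQ hQs hs _ _ h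
  obtain ⟨z, hz⟩ := sub_one_dvd_sub_mapDomainAlgHom k hP x
  exact ⟨y, z, by linear_combination hz + hy⟩

theorem exists_eq_sub_one_mul_add_of_augmentation_eq_zero
    (hQ : ∀ g, ∃ i : ℕ, g = Q g * s ^ i) (hP : ∀ g, ∃ i : ℕ, g = P g * t ^ i)
    (hQP : ∀ g, Q (P g) = 1) (x : MonoidAlgebra k G)
    (hx : lift k k G 1 x = 0) :
    ∃ y z, x = (of k G s - 1) * y + (of k G t - 1) * z := by
  obtain ⟨z, hz⟩ := sub_one_dvd_sub_mapDomainAlgHom k hP x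
  obtain ⟨y, hy⟩ := sub_one_dvd_sub_mapDomainAlgHom k hQ (mapDomainAlgHom k k P x)
  have h : mapDomainAlgHom k k Q (mapDomainAlgHom k k P x) = single 1 (lift k k G 1 x) := by
    clear hx hy hz
    induction x using MonoidAlgebra.induction_linear with
    | zero => simp
    | add x y hx hy => rw [map_add, map_add, hx, hy, map_add, single_add]
    | single g r => simp [hQP]
  rw [h, hx, single_zero, sub_zero] at hy
  exact ⟨y, z, by linear_combination hz + hy⟩

end TwoGenerators

end MonoidAlgebra

/-! ### The tensor product resolution. -/

namespace Rep.ProductCyclic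

variable (k : Type u) [CommRing k] {G : Type u} [CommGroup G] (s t : G) (m n : ℕ)

instance free_fin_projective (q : ℕ) : Projective (free k G (Fin q)) :=
  equivalenceModuleMonoidAlgebra.toAdjunction.projective_of_map_projective _ <|
    @ModuleCat.projective_of_free _ _
      (ModuleCat.of (MonoidAlgebra k G) (Representation.free k G (Fin q)).asModule)
      _ (Representation.freeAsModuleBasis k G (Fin q))

variable {k} in
theorem free_apply (q : ℕ) (g : G) (x : Fin q →₀ MonoidAlgebra k G) (i : Fin q) :
    Representation.free k G (Fin q) g x i = single g 1 * x i := by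
  induction x using Finsupp.induction_linear with
  | zero => simp
  | add x y hx hy => rw [map_add, Finsupp.add_apply, hx, hy, Finsupp.add_apply, mul_add]
  | single j x =>
    rw [Representation.free, Representation.finsupp_single]
    rcases eq_or_ne i j with rfl | hij
    · rw [Finsupp.single_eq_same, Finsupp.single_eq_same]
      induction x using MonoidAlgebra.induction_linear with
      | zero => simp
      | add x y hx hy => rw [map_add, hx, hy, mul_add]
      | single h r => simp
    · rw [Finsupp.single_eq_of_ne hij, Finsupp.single_eq_of_ne hij, mul_zero]

/-- A morphism from a free representation to a trivial one factors through the augmentation. -/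
theorem hom_trivial_apply {A : Type u} [AddCommGroup A] [Module k A] {q : ℕ}
    (f : free k G (Fin q) ⟶ trivial k G A) (x : Fin q →₀ MonoidAlgebra k G) :
    f.hom x = ∑ i, lift k k G 1 (x i) • f.hom (Finsupp.single i (single 1 1)) := by
  induction x using Finsupp.induction_linear with
  | zero => simp
  | add x y hx hy =>
    rw [map_add, hx, hy, ← Finset.sum_add_distrib]
    simp only [Finsupp.add_apply, map_add, add_smul]
  | single j x =>
    rw [Finset.sum_eq_single j (fun i _ hij => by rw [Finsupp.single_eq_of_ne hij]; simp) (by simp),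
      Finsupp.single_eq_same]
    induction x using MonoidAlgebra.induction_linear with
    | zero => simp
    | add x y hx hy => rw [Finsupp.single_add, map_add, hx, hy, map_add, add_smul]
    | single g r =>
      have h := hom_comm_apply f g (Finsupp.single j (single 1 r))
      have h1 : (free k G (Fin q)).ρ g (Finsupp.single j (single 1 r)) =
          Finsupp.single j (single g r) := by simp
      have h2 : Finsupp.single j (single (1 : G) r) = r • Finsupp.single j (single (1 : G) 1) := by
        simp
      rw [← h1, h, h2, map_smul, lift_single]
      simp

/-- The linear map underlying `Rep.ProductCyclic.d`. -/
noncomputable def dLinear (q : ℕ) :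
    (Fin (q + 2) →₀ MonoidAlgebra k G) →ₗ[k] (Fin (q + 1) →₀ MonoidAlgebra k G) where
  toFun x := Finsupp.equivFunOnFinite.symm fun i =>
    periodicCoeff k s m (i + 1) * x i.succ +
      (-1) ^ (i : ℕ) * periodicCoeff k t n (q + 1 - i) * x i.castSucc
  map_add' x y := by
    ext1 i
    simp only [Finsupp.coe_equivFunOnFinite_symm, Finsupp.add_apply]
    ring
  map_smul' r x := by
    ext1 i
    simp

/-- The differential of the total complex of the tensor product of the periodic resolutions
attached to `s` and `t`. The `i`-th summand in degree `q` has bidegree `(i, q - i)`. -/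
noncomputable def d (q : ℕ) : free k G (Fin (q + 2)) ⟶ free k G (Fin (q + 1)) :=
  Rep.ofHom ⟨dLinear k s t m n q, fun g => by
    refine LinearMap.ext fun x => Finsupp.ext fun i => ?_
    change _ = Representation.free k G (Fin (q + 1)) g (dLinear k s t m n q x) i
    rw [free_apply]
    simp only [dLinear, LinearMap.comp_apply, LinearMap.coe_mk, AddHom.coe_mk,
      Finsupp.coe_equivFunOnFinite_symm, free_apply]
    ring⟩

theorem dLinear_eq (q : ℕ) : (d k s t m n q).hom.toLinearMap = dLinear k s t m n q := rfl

theorem dLinear_apply (q : ℕ) (x : Fin (q + 2) →₀ MonoidAlgebra k G) (i : Fin (q + 1)) :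
    dLinear k s t m n q x i = periodicCoeff k s m (i + 1) * x i.succ +
      (-1) ^ (i : ℕ) * periodicCoeff k t n (q + 1 - i) * x i.castSucc := rfl

variable {s t m n}

theorem d_comp_d (hs : s ^ m = 1) (ht : t ^ n = 1) (q : ℕ) :
    d k s t m n (q + 1) ≫ d k s t m n q = 0 := by
  refine Rep.hom_ext <| Representation.IntertwiningMap.ext <| LinearMap.ext fun x =>
    Finsupp.ext fun i => ?_
  change dLinear k s t m n q (dLinear k s t m n (q + 1) x) i = 0
  obtain ⟨j, hj⟩ : ∃ j, q = i + j := ⟨q - i, by omega⟩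
  have h1 := periodicCoeff_mul_periodicCoeff k hs (i + 1)
  have h2 := periodicCoeff_mul_periodicCoeff k ht (j + 1)
  have h3 : ((-1 : MonoidAlgebra k G) ^ (i : ℕ)) * (-1) ^ (i : ℕ) = 1 := by
    rw [← mul_pow]; simp
  simp only [dLinear_apply, Fin.val_succ, Fin.val_castSucc, Fin.succ_castSucc]
  rw [show q + 1 + 1 - (i + 1 : ℕ) = j + 1 by omega, show q + 1 - (i : ℕ) = j + 1 by omega,
    show q + 1 + 1 - (i : ℕ) = j + 1 + 1 by omega, pow_succ]
  linear_combination x i.succ.succ * h1 + x i.castSucc.castSucc * ((-1) ^ (i : ℕ) * (-1) ^ (i : ℕ))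
    * h2

/-- The total complex of the tensor product of two periodic resolutions. -/
noncomputable abbrev complex (hs : s ^ m = 1) (ht : t ^ n = 1) : ChainComplex (Rep k G) ℕ :=
  ChainComplex.of (fun q => free k G (Fin (q + 1))) (fun q => d k s t m n q)
    fun q => d_comp_d k hs ht q

theorem complex_d (hs : s ^ m = 1) (ht : t ^ n = 1) (q : ℕ) :
    (complex k hs ht).d (q + 1) q = d k s t m n q :=
  ChainComplex.of_d (fun q => free k G (Fin (q + 1))) (fun q => d k s t m n q) q

/-- The augmentation in degree zero. -/
noncomputable def ε : free k G (Fin 1) ⟶ trivial k G k :=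
  freeLift k G (trivial k G k) fun _ => (1 : k)

theorem ε_apply (x : Fin 1 →₀ MonoidAlgebra k G) : (ε k).hom x = lift k k G 1 (x 0) := by
  rw [hom_trivial_apply]
  simp [ε]

theorem d_comp_ε : d k s t m n 0 ≫ ε k = 0 := by
  refine Rep.hom_ext (Representation.IntertwiningMap.ext <| LinearMap.ext fun x => ?_)
  change (ε k).hom (dLinear k s t m n 0 x) = 0
  rw [ε_apply, dLinear_apply]
  simp [periodicCoeff]

/-- The augmentation of the total complex. -/
noncomputable def π (hs : s ^ m = 1) (ht : t ^ n = 1) :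
    complex k hs ht ⟶ (ChainComplex.single₀ (Rep k G)).obj (trivial k G k) :=
  ((complex k hs ht).toSingle₀Equiv _).symm ⟨ε k, (complex_d k hs ht 0).symm ▸ d_comp_ε k⟩

/-- `G` is the internal product of the cyclic subgroups generated by `s`, of order `m`, and `t`,
of order `n`: the endomorphism `P` projects along `t`, and `Q` along `s`. -/
structure IsInternalProduct (s t : G) (m n : ℕ) (P Q : G →* G) : Prop where
  pos_left : 0 < m
  pos_right : 0 < n
  orderOf_left : orderOf s = m
  orderOf_right : orderOf t = n
  eq_left : ∀ g, ∃ i : ℕ, g = Q g * s ^ i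
  eq_right : ∀ g, ∃ i : ℕ, g = P g * t ^ i
  map_left : P s = s
  map_right : P t = 1
  map_left' : Q s = 1
  comp : ∀ g, Q (P g) = 1

variable {P Q : G →* G} (h : IsInternalProduct s t m n P Q)
include h

theorem IsInternalProduct.pow_left : s ^ m = 1 := h.orderOf_left ▸ pow_orderOf_eq_one s

theorem IsInternalProduct.pow_right : t ^ n = 1 := h.orderOf_right ▸ pow_orderOf_eq_one t

theorem range_d_zero : LinearMap.range (dLinear k s t m n 0) =
    LinearMap.ker (ε (G := G) k).hom.toLinearMap := by
  refine le_antisymm ?_ fun x hx => ?_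
  · rintro _ ⟨x, rfl⟩
    exact congr($(d_comp_ε k (s := s) (t := t) (m := m) (n := n)).hom x)
  · obtain ⟨y, z, hyz⟩ := exists_eq_sub_one_mul_add_of_augmentation_eq_zero k h.eq_left h.eq_right
      h.comp (x 0) ((ε_apply k x).symm.trans hx)
    refine ⟨Finsupp.equivFunOnFinite.symm ![z, y], Finsupp.ext fun i => ?_⟩
    rw [show i = 0 from Fin.fin_one_eq_zero i, dLinear_apply, hyz]
    simp [periodicCoeff]

theorem range_d_succ (q : ℕ) : LinearMap.range (dLinear k s t m n (q + 1)) =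
    LinearMap.ker (dLinear k s t m n q) := by
  refine le_antisymm ?_ fun x hx => ?_
  · rintro _ ⟨x, rfl⟩
    exact congr($(d_comp_d k h.pow_left h.pow_right q).hom x)
  · obtain ⟨y, hy⟩ := exists_total_boundary_of_total_cycle
      (a := periodicCoeff k s m) (b := periodicCoeff k t n)
      (fun j => exists_eq_periodicCoeff_mul k h.pos_right h.eq_right h.map_right h.orderOf_right _)
      (fun i => exists_eq_periodicCoeff_mul_add k h.pos_left h.eq_left h.map_left' h.orderOf_left
        h.eq_right h.map_right h.map_left _)
      (fun i => periodicCoeff_mul_periodicCoeff k h.pow_left _)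
      -- The default `0` is never read: only indices up to `q + 1` occur.
      q (fun i => if hi : i < q + 2 then x ⟨i, hi⟩ else 0) (fun i hi => by
        rw [dif_pos (by omega), dif_pos (by omega)]
        exact congr($hx (⟨i, by omega⟩ : Fin (q + 1))))
    refine ⟨Finsupp.equivFunOnFinite.symm fun i => y i, Finsupp.ext fun i => ?_⟩
    have := hy i (by omega)
    rw [dif_pos i.2] at this
    exact this

omit h in
theorem ε_surjective : Function.Surjective (ε (G := G) k).hom := fun r =>
  ⟨Finsupp.single 0 (single 1 r), by rw [ε_apply]; simp⟩

theorem quasiIso_π : QuasiIso (π k h.pow_left h.pow_right) where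
  quasiIsoAt q := by
    induction q with
    | zero =>
      simp only [π]
      rw [ChainComplex.quasiIsoAt₀_iff, ShortComplex.quasiIso_iff_of_zeros' _ rfl rfl rfl]
      constructor
      · apply (forget₂ _ (ModuleCat k)).reflects_exact_of_faithful
        simpa [ShortComplex.moduleCat_exact_iff_range_eq_ker, ChainComplex.toSingle₀Equiv] using!
          range_d_zero k h
      · rw [Rep.epi_iff_surjective]
        simpa [ChainComplex.toSingle₀Equiv] using! ε_surjective k
    | succ q _ =>
      rw [quasiIsoAt_iff_exactAt' (hL := ChainComplex.exactAt_succ_single_obj ..),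
          HomologicalComplex.exactAt_iff' _ (q + 2) (q + 1) q (by simp) (by simp)]
      apply (forget₂ _ (ModuleCat k)).reflects_exact_of_faithful
      rw [ShortComplex.moduleCat_exact_iff_range_eq_ker]
      have e := range_d_succ k h q
      rw [← dLinear_eq, ← dLinear_eq, ← complex_d k h.pow_left h.pow_right,
        ← complex_d k h.pow_left h.pow_right] at e
      exact e

/-- The tensor product of two periodic resolutions is a projective resolution of `k` as a trivial
representation of a product of two finite cyclic groups. -/
noncomputable def resolution : ProjectiveResolution (trivial k G k) where
  complex := complex k h.pow_left h.pow_right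
  projective q := inferInstanceAs (Projective (free k G (Fin (q + 1))))
  π := π k h.pow_left h.pow_right
  quasiIso := quasiIso_π k h

end Rep.ProductCyclic

/-- The homology of a short complex of modules, computed by a surjection from the cycles. -/
theorem CategoryTheory.ShortComplex.nonempty_homology_addEquiv {R : Type u} [CommRing R]
    (S : ShortComplex (ModuleCat.{u} R)) {T : Type*} [AddCommGroup T]
    (Φ : LinearMap.ker S.g.hom →+ T) (hΦ : Function.Surjective Φ)
    (hker : ∀ z, Φ z = 0 ↔ ∃ y, S.f y = z.1) : Nonempty (S.homology ≃+ T) := by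
  let e : S.homology ≃+ (LinearMap.ker S.g.hom ⧸ LinearMap.range S.moduleCatToCycles) :=
    S.moduleCatHomologyIso.toLinearEquiv.toAddEquiv
  have hk : (LinearMap.range S.moduleCatToCycles).toAddSubgroup = Φ.ker := by
    ext z
    rw [AddMonoidHom.mem_ker, hker]
    exact ⟨fun ⟨y, hy⟩ => ⟨y, congr($hy.1)⟩, fun ⟨y, hy⟩ => ⟨y, Subtype.ext hy⟩⟩
  exact ⟨e.trans ((QuotientAddGroup.quotientAddEquivOfEq hk).trans
    (QuotientAddGroup.quotientKerEquivOfSurjective Φ hΦ))⟩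

namespace MonoidAlgebra

theorem augmentation_periodicCoeff (k : Type*) [CommRing k] {G : Type*} [CommGroup G] (t : G)
    (n i : ℕ) : lift k k G 1 (periodicCoeff k t n i) = if Even i then (n : k) else 0 := by
  have h : lift k k G 1 (of k G t) = 1 := by simp
  rw [periodicCoeff]
  split_ifs
  · simp [cyclicNorm, map_sum, map_pow, h, -of_apply]
  · rw [map_sub, h, map_one, sub_self]

end MonoidAlgebra

/-! ### Arithmetic of the middle component. -/

section Gcd

variable {V : Type*} [AddCommGroup V] {m n : ℕ}

theorem div_gcd_bezout (hm : 0 < m) : ∃ x y : ℤ,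
    ((m / m.gcd n : ℕ) : ℤ) * x + ((n / m.gcd n : ℕ) : ℤ) * y = 1 := by
  have h : (m / m.gcd n).gcd (n / m.gcd n) = 1 :=
    Nat.coprime_div_gcd_div_gcd (Nat.gcd_pos_of_pos_left n hm)
  refine ⟨_, _, (Nat.gcd_eq_gcd_ab _ _).symm.trans ?_⟩
  rw [h, Nat.cast_one]

theorem nsmul_div_gcd_add_eq_zero_iff (hm : 0 < m) (hV : ∀ v : V, ∃ w, m.gcd n • w = v)
    (u v : V) : (m / m.gcd n) • u + (n / m.gcd n) • v = 0 ↔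
      ∃ w, -(n • w) = u ∧ m • w = v := by
  obtain ⟨x, y, hxy⟩ := div_gcd_bezout (n := n) hm
  have hma : m = m / m.gcd n * m.gcd n := (Nat.div_mul_cancel (m.gcd_dvd_left n)).symm
  have hnb : n = n / m.gcd n * m.gcd n := (Nat.div_mul_cancel (m.gcd_dvd_right n)).symm
  generalize m.gcd n = g at *
  generalize m / g = a at *
  generalize n / g = b at *
  subst hma hnb
  simp only [← natCast_zsmul] at *
  push_cast
  constructor
  · intro h
    -- Forced by Bézout: `g w = x (g a w) + y (g b w)`, wrapped as `a x + b y = 1` with `v = g a w`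
    -- and `u = -(g b w)`.
    obtain ⟨w, hw⟩ := hV (-y • u + x • v)
    have hu : u = ((a : ℤ) * x + b * y) • u := by rw [hxy, one_smul]
    have hv : v = ((a : ℤ) * x + b * y) • v := by rw [hxy, one_smul]
    refine ⟨w, ?_, ?_⟩
    · rw [mul_smul, hw]
      nth_rw 2 [hu]
      linear_combination (norm := module) (-x) • h
    · rw [mul_smul, hw]
      nth_rw 2 [hv]
      linear_combination (norm := module) (-y) • h
  · rintro ⟨w, rfl, rfl⟩
    module

theorem exists_nsmul_div_gcd_add_eq (hm : 0 < m) {w : V} (hw : m.gcd n • w = 0) :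
    ∃ u v : V, m • u + n • v = 0 ∧ (m / m.gcd n) • u + (n / m.gcd n) • v = w := by
  obtain ⟨x, y, hxy⟩ := div_gcd_bezout (n := n) hm
  have h : (m / m.gcd n) • x • w + (n / m.gcd n) • y • w = w := by
    simp only [← natCast_zsmul]
    rw [smul_smul, smul_smul, ← add_smul, hxy, one_smul]
  refine ⟨x • w, y • w, ?_, h⟩
  have h' := congr(m.gcd n • $h)
  rwa [smul_add, smul_smul, smul_smul, Nat.mul_div_cancel' (m.gcd_dvd_left n),
    Nat.mul_div_cancel' (m.gcd_dvd_right n), hw] at h'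

end Gcd

/-! ### Cochains with trivial coefficients and the third cohomology. -/

namespace Rep.ProductCyclic

variable (k : Type u) [CommRing k] {G : Type u} [CommGroup G] {s t : G} {m n : ℕ}
  {V : Type u} [AddCommGroup V] [Module k V]

/-- The value of a morphism from a free representation at a basis vector. -/
noncomputable abbrev evalBasis {q : ℕ} (f : free k G (Fin q) ⟶ trivial k G V) (i : Fin q) : V :=
  f.hom (Finsupp.single i (single 1 1))

theorem evalBasis_d_comp {q : ℕ} (f : free k G (Fin (q + 1)) ⟶ trivial k G V) (j : Fin (q + 2)) :
    evalBasis k (d k s t m n q ≫ f) j = ∑ i : Fin (q + 1),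
      ((if j = i.succ then (if Even (i + 1 : ℕ) then (m : k) else 0) else 0) +
       (-1) ^ (i : ℕ) * (if j = i.castSucc then
        (if Even (q + 1 - i : ℕ) then (n : k) else 0) else 0)) • evalBasis k f i := by
  have h : evalBasis k (d k s t m n q ≫ f) j =
    f.hom (dLinear k s t m n q (Finsupp.single j (single 1 1))) := rfl
  rw [h, hom_trivial_apply]
  refine Finset.sum_congr rfl fun i _ => ?_
  congr 1
  have hs : ∀ l : Fin (q + 2), lift k k G 1 (Finsupp.single j (single (1 : G) (1 : k)) l) =
      if j = l then 1 else 0 := fun l => by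
    rw [Finsupp.single_apply]
    split_ifs <;> simp
  rw [dLinear_apply]
  simp only [map_add, map_mul, map_pow, map_neg, map_one, augmentation_periodicCoeff, hs]
  simp

theorem evalBasis_d_two_comp (f : free k G (Fin 3) ⟶ trivial k G V) :
    evalBasis k (d k s t m n 2 ≫ f) =
      ![0, -(n • evalBasis k f 1), m • evalBasis k f 1, 0] := by
  funext j
  rw [evalBasis_d_comp, Fin.sum_univ_three]
  fin_cases j <;> simp [Fin.ext_iff, Nat.even_iff, Nat.cast_smul_eq_nsmul]

theorem evalBasis_d_three_comp (f : free k G (Fin 4) ⟶ trivial k G V) :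
    evalBasis k (d k s t m n 3 ≫ f) =
      ![n • evalBasis k f 0, 0, m • evalBasis k f 1 + n • evalBasis k f 2, 0,
        m • evalBasis k f 3] := by
  funext j
  rw [evalBasis_d_comp, Fin.sum_univ_four]
  fin_cases j <;> simp [Fin.ext_iff, Nat.even_iff, Nat.cast_smul_eq_nsmul]

variable {P Q : G →* G}

/-- A morphism from a free representation to a trivial one with given values at the basis. -/
theorem exists_evalBasis_eq {q : ℕ} (v : Fin q → V) :
    ∃ f : free k G (Fin q) ⟶ trivial k G V, evalBasis k f = v :=
  ⟨freeLift k G (trivial k G V) v, (freeLiftLEquiv k G (Fin q) (trivial k G V)).right_inv v⟩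

theorem evalBasis_injective {q : ℕ} :
    Function.Injective (evalBasis k : (free k G (Fin q) ⟶ trivial k G V) → Fin q → V) :=
  (freeLiftLEquiv k G (Fin q) (trivial k G V)).injective

theorem d_three_comp_eq_zero_iff (f : free k G (Fin 4) ⟶ trivial k G V) :
    d k s t m n 3 ≫ f = 0 ↔ n • evalBasis k f 0 = 0 ∧
      m • evalBasis k f 1 + n • evalBasis k f 2 = 0 ∧ m • evalBasis k f 3 = 0 := by
  have h0 : evalBasis k (0 : free k G (Fin 5) ⟶ trivial k G V) = 0 := rfl
  rw [← (evalBasis_injective k).eq_iff, evalBasis_d_three_comp, h0, funext_iff]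
  simp [Fin.forall_fin_succ]

theorem exists_d_two_comp_eq_iff (f : free k G (Fin 4) ⟶ trivial k G V) :
    (∃ g, d k s t m n 2 ≫ g = f) ↔ evalBasis k f 0 = 0 ∧
      (∃ w, -(n • w) = evalBasis k f 1 ∧ m • w = evalBasis k f 2) ∧ evalBasis k f 3 = 0 := by
  constructor
  · rintro ⟨g, rfl⟩
    rw [evalBasis_d_two_comp]
    exact ⟨rfl, ⟨_, rfl, rfl⟩, rfl⟩
  · rintro ⟨h0, ⟨w, h1, h2⟩, h3⟩
    obtain ⟨g, hg⟩ := exists_evalBasis_eq (G := G) k ![0, w, 0]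
    refine ⟨g, evalBasis_injective k ?_⟩
    rw [evalBasis_d_two_comp, hg]
    funext i
    fin_cases i
    · exact h0.symm
    · exact h1
    · exact h2
    · exact h3.symm

theorem nonempty_groupCohomology_three_addEquiv (h : IsInternalProduct s t m n P Q)
    (hV : ∀ v : V, ∃ w, m.gcd n • w = v) :
    Nonempty (groupCohomology (trivial k G V) 3 ≃+
      (nsmulAddMonoidHom (α := V) m).ker × (nsmulAddMonoidHom (α := V) (m.gcd n)).ker ×
        (nsmulAddMonoidHom (α := V) n).ker) := by
  let K := (resolution k h).complex.linearYonedaObj k (trivial k G V)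
  let e : groupCohomology (trivial k G V) 3 ≃+ (K.sc' 2 3 4).homology :=
    (groupCohomologyIso (trivial k G V) 3 (resolution k h) ≪≫
      ShortComplex.homologyMapIso (K.isoSc' 2 3 4 (by simp) (by simp))).toLinearEquiv.toAddEquiv
  have hf : ∀ f : free k G (Fin 3) ⟶ trivial k G V, (K.sc' 2 3 4).f f = d k s t m n 2 ≫ f :=
    fun f => congr($(complex_d k h.pow_left h.pow_right 2) ≫ f)
  have hg : ∀ f : free k G (Fin 4) ⟶ trivial k G V, (K.sc' 2 3 4).g f = d k s t m n 3 ≫ f :=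
    fun f => congr($(complex_d k h.pow_left h.pow_right 3) ≫ f)
  let ev (z : LinearMap.ker (K.sc' 2 3 4).g.hom) : Fin 4 → V :=
    evalBasis (G := G) k (q := 4) z.1
  have hev : ∀ y z, ev (y + z) = ev y + ev z := fun _ _ => rfl
  have hz : ∀ z, n • ev z 0 = 0 ∧ m • ev z 1 + n • ev z 2 = 0 ∧ m • ev z 3 = 0 := fun z =>
    (d_three_comp_eq_zero_iff k _).1 ((hg z.1).symm.trans z.2)
  have hev_surj : ∀ v : Fin 4 → V, n • v 0 = 0 → m • v 1 + n • v 2 = 0 → m • v 3 = 0 →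
      ∃ z, ev z = v := fun v h0 h1 h3 => by
    obtain ⟨f, rfl⟩ := exists_evalBasis_eq (G := G) k v
    exact ⟨⟨f, (hg f).trans ((d_three_comp_eq_zero_iff k f).2 ⟨h0, h1, h3⟩)⟩, rfl⟩
  have hbd : ∀ z, (∃ y, (K.sc' 2 3 4).f y = z.1) ↔ ev z 0 = 0 ∧
      (∃ w, -(n • w) = ev z 1 ∧ m • w = ev z 2) ∧ ev z 3 = 0 := fun z => by
    refine Iff.trans ?_ (exists_d_two_comp_eq_iff (s := s) (t := t) k z.1)
    exact exists_congr fun y => Eq.congr (hf y) rfl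
  let Φ : LinearMap.ker (K.sc' 2 3 4).g.hom →+
      (nsmulAddMonoidHom (α := V) m).ker × (nsmulAddMonoidHom (α := V) (m.gcd n)).ker ×
        (nsmulAddMonoidHom (α := V) n).ker :=
    { toFun z := (⟨ev z 3, (hz z).2.2⟩,
        ⟨(m / m.gcd n) • ev z 1 + (n / m.gcd n) • ev z 2, by
          rw [AddMonoidHom.mem_ker, nsmulAddMonoidHom_apply, smul_add, smul_smul, smul_smul,
            Nat.mul_div_cancel' (m.gcd_dvd_left n), Nat.mul_div_cancel' (m.gcd_dvd_right n)]
          exact (hz z).2.1⟩,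
        ⟨ev z 0, (hz z).1⟩)
      map_zero' := by
        have h0 : ev 0 = 0 := rfl
        simp [h0]
      map_add' y z := by
        ext <;> simp [hev]
        abel }
  refine ⟨e.trans (ShortComplex.nonempty_homology_addEquiv _ Φ ?_ ?_).some⟩
  · rintro ⟨⟨u, hu⟩, ⟨w, hw⟩, ⟨v, hv⟩⟩
    obtain ⟨x, y, hxy, rfl⟩ := exists_nsmul_div_gcd_add_eq (n := n) h.pos_left hw
    obtain ⟨z, hz⟩ := hev_surj ![v, x, y, u] hv hxy hu
    refine ⟨z, ?_⟩
    simp [Φ, hz]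
  · intro z
    have hΦ : Φ z = 0 ↔ ev z 3 = 0 ∧ (m / m.gcd n) • ev z 1 + (n / m.gcd n) • ev z 2 = 0 ∧
        ev z 0 = 0 := by
      rw [Prod.ext_iff, Prod.ext_iff, Subtype.ext_iff, Subtype.ext_iff, Subtype.ext_iff]
      rfl
    rw [hbd, ← nsmul_div_gcd_add_eq_zero_iff h.pos_left hV, hΦ]
    tauto

end Rep.ProductCyclic

/-! ### Torsion and divisibility of `kˣ`, and the concrete group. -/

theorem nonempty_ker_nsmul_units_addEquiv (k : Type*) [Field k] [IsAlgClosed k] [CharZero k]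
    (n : ℕ) (hn : 0 < n) :
    Nonempty ((nsmulAddMonoidHom (α := Additive kˣ) n).ker ≃+ ZMod n) := by
  have : NeZero n := ⟨hn.ne'⟩
  have : NeZero (n : k) := ⟨by exact_mod_cast hn.ne'⟩
  have e1 : (nsmulAddMonoidHom (α := Additive kˣ) n).ker ≃+ Additive (rootsOfUnity n k) :=
    { toFun x := Additive.ofMul ⟨x.1.toMul, x.2⟩
      invFun x := ⟨Additive.ofMul x.toMul.1, x.toMul.2⟩
      left_inv _ := rfl
      right_inv _ := rfl
      map_add' _ _ := rfl }
  have e2 := zmodAddCyclicAddEquiv (G := Additive (rootsOfUnity n k)) inferInstance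
  have hc : Nat.card (Additive (rootsOfUnity n k)) = n :=
    HasEnoughRootsOfUnity.natCard_rootsOfUnity k n
  rw [hc] at e2
  exact ⟨e1.trans e2.symm⟩

theorem exists_nsmul_units_eq {k : Type*} [Field k] [IsAlgClosed k] {n : ℕ} (hn : 0 < n)
    (v : Additive kˣ) : ∃ w, n • w = v := by
  obtain ⟨z, hz⟩ := IsAlgClosed.exists_pow_nat_eq (v.toMul : k) hn
  have hz0 : z ≠ 0 := by
    rintro rfl
    rw [zero_pow hn.ne'] at hz
    exact v.toMul.ne_zero hz.symm
  exact ⟨Additive.ofMul (Units.mk0 z hz0), Units.ext hz⟩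

open Rep.ProductCyclic in
theorem exists_isInternalProduct (m n : ℕ) (hm : 0 < m) (hn : 0 < n) :
    ∃ (s t : ULift.{u} (Multiplicative (ZMod m) × Multiplicative (ZMod n))) (P Q : _ →* _),
      IsInternalProduct s t m n P Q := by
  have : NeZero m := ⟨hm.ne'⟩
  have : NeZero n := ⟨hn.ne'⟩
  let E : ULift.{u} (Multiplicative (ZMod m) × Multiplicative (ZMod n)) ≃*
    Multiplicative (ZMod m) × Multiplicative (ZMod n) := MulEquiv.ulift
  have horder : ∀ x, orderOf (E.symm x) = orderOf x := fun x => E.symm.orderOf_eq x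
  have hgen : ∀ (r : ℕ) [NeZero r] (x : Multiplicative (ZMod r)),
      x = Multiplicative.ofAdd (1 : ZMod r) ^ (x.toAdd.val) := fun r _ x => by
    rw [← ofAdd_nsmul]
    simp
  refine ⟨E.symm (Multiplicative.ofAdd 1, 1), E.symm (1, Multiplicative.ofAdd 1),
    E.symm.toMonoidHom.comp (((MonoidHom.inl _ _).comp (MonoidHom.fst _ _)).comp E.toMonoidHom),
    E.symm.toMonoidHom.comp (((MonoidHom.inr _ _).comp (MonoidHom.snd _ _)).comp E.toMonoidHom),
    { pos_left := hm
      pos_right := hn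
      orderOf_left := ?_
      orderOf_right := ?_
      eq_left := fun g => ⟨(E g).1.toAdd.val, ?_⟩
      eq_right := fun g => ⟨(E g).2.toAdd.val, ?_⟩
      map_left := by simp
      map_right := by simp
      map_left' := by simp
      comp := by simp }⟩
  · rw [horder, Prod.orderOf_mk]
    simp
  · rw [horder, Prod.orderOf_mk]
    simp
  · apply E.injective
    ext1
    · simpa using hgen m _
    · simp
  · apply E.injective
    ext1
    · simp
    · simpa using hgen n _

theorem corollary3p8 {k : Type u} [Field k] [IsAlgClosed k] [CharZero k]
    (m n : ℕ) (hm : 0 < m) (hn : 0 < n) :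
    Nonempty (H3Units k (ULift.{u} (Multiplicative (ZMod m) × Multiplicative (ZMod n))) ≃+
      ZMod m × ZMod (Nat.gcd m n) × ZMod n) := by
  have hd : 0 < m.gcd n := Nat.gcd_pos_of_pos_left n hm
  obtain ⟨s, t, P, Q, h⟩ := exists_isInternalProduct.{u} m n hm hn
  obtain ⟨e⟩ := Rep.ProductCyclic.nonempty_groupCohomology_three_addEquiv (ULift.{u} ℤ)
    (V := Additive kˣ) h (exists_nsmul_units_eq hd)
  obtain ⟨e1⟩ := nonempty_ker_nsmul_units_addEquiv k m hm
  obtain ⟨e2⟩ := nonempty_ker_nsmul_units_addEquiv k _ hd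
  obtain ⟨e3⟩ := nonempty_ker_nsmul_units_addEquiv k n hn
  exact ⟨e.trans (e1.prodCongr (e2.prodCongr e3))⟩
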